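/- **Setting (BTTP).** Let $X$ and $Y$ be two leagues of $n\ge 1$ teams. For $x\in X$, $y\in Y$ write $x\to y$ for a game between $x$ and $y$ at the home of $y$; for a set $A$ of games let $\overline{A}$ be the same games with reversed venues. A *feasible schedule* assigns games to $2n$ consecutive days such that every team plays exactly one game on each day, every $x\in X$ and $y\in Y$ play exactly once at the home of $x$ and exactly once at the home of $y$, no pair of teams meets on two consecutive days (no-repeat), and no team plays more than three consecutive home games or more than three consecutive away games (bounded-by-3). **Parameters.** Call $(m,d)$ *admissible for $n$* if $m,d\ge 1$ are integers, $m$ is odd, $3md\le n$ and $l:=n-3md\le m$. **The modified 3-path construction.** Let $(m,d)$ be admissible for $n$, and label the teams arbitrarily as $X=\{x_0,\dots,x_{n-1}\}$, $Y=\{y_0,\dots,y_{n-1}\}$ (the triples $x_{3i}x_{3i+1}x_{3i+2}$ and $y_{3i}y_{3i+1}y_{3i+2}$, $0\le i<md$, being the given 3-paths). For $0\le i<m$ let $S_i=\{x_{3di},\dots,x_{3di+3d-1}\}$, $T_i=\{y_{3di},\dots,y_{3di+3d-1}\}$ (super-teams), and for $0\le p<l$ let $L_p=\{x_{3md+p},y_{3md+p}\}$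 (team-pairs). There are $m$ time slots of $6d$ days each, followed by a last time slot of $2l$ days. In time slot $\tau\in\{0,\dots,m-1\}$, for each position $p\in\{0,\dots,m-1\}$ the super-teams $S_{(p+\tau)\bmod m}=\{s_0,\dots,s_{3d-1}\}$ and $T_{(p+2\tau)\bmod m}=\{t_0,\dots,t_{3d-1}\}$ (listed in the order of their labels) play a super-game on the days $0,\dots,6d-1$ of the slot, as follows. * If $p\ge l$ (normal super-game): for $0\le i,j<d$ and $0\le i',j'\le 2$, the game $s_{3i+i'}\to t_{3j+j'}$ is on day $(6(i+j)+i'+j')\bmod 6d$, and the game with reversed venue is on day $(6(i+j)+i'+j'+3)\bmod 6d$. * If $p<l$ (left super-game): put $s_{3d}=x_{3md+p}$, $t_{3d}=y_{3md+p}$ and $m_i=\{s_k\to t_{(k+i)\bmod(3d+1)}: 0\le k\le 3d\}$. The games on the $6d$ days are $m_1\overline{m_2}m_3\overline{m_4}\cdots\overline{m_{3d}}\cdot m_2\overline{m_3}m_4\cdots m_{3d}\overline{m_1}$ if $d$ is even, and $m_1\overline{m_2}m_3\cdots m_{3d}\cdot\overline{m_1}m_2\overline{m_3}\cdots\overline{m_{3d}}$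 if $d$ is odd. For $0\le i<l$ let $A_i$ consist of the games $x_{3md+k}\to y_{3md+((k+i)\bmod l)}$, $0\le k<l$, and of the games $s_k\to t_k$, $0\le k<3d$, of all $m$ left super-games with team-pair $L_i$ (these were not played there). The games on the $2l$ days of the last time slot are $A_0\overline{A_1}A_2\overline{A_3}\cdots$ ($l$ days), followed by the same $l$ days with all venues reversed. Finally, if $l=1$ and $g_1g_2\dots g_{2n}$ are the days obtained so far, they are rearranged as $g_{2n}g_1g_2\dots g_{2n-1}$. **Theorem.** Let $n\ge1$. For every $(m,d)$ that is admissible for $n$ and every labelling of the teams, the modified 3-path construction produces a feasible schedule. Moreover, admissible $(m,d)$ exist if and only if $n\notin\{1,2,5,8,14\}$. Hence the modified 3-path construction generates a feasible solution of BTTP for every $n\ge1$ except $n\in\{1,2,5,8,14\}$. -/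

import Mathlib

namespace BTTP

/-! ### Games, schedules and feasibility -/

/-- The league at whose team's home a game is played. -/
inductive Venue where
  | X
  | Y
deriving DecidableEq

/-- The other venue. -/
def Venue.swap : Venue → Venue
  | .X => .Y
  | .Y => .X

/-- A game between a team `x` of the first league and a team `y` of the second league, with the
league whose team plays at home. -/
structure Game (X Y : Type*) where
  x : X
  y : Y
  venue : Venue
deriving DecidableEq

/-- `away x y` is the game `x → y`, played at the home of `y`. -/
def away {X Y : Type*} (x : X) (y : Y) : Game X Y := ⟨x, y, .Y⟩

/-- The same game with reversed venue. -/
def Game.rev {X Y : Type*} (g : Game X Y) : Game X Y := ⟨g.x, g.y, g.venue.swap⟩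

/-- A schedule of a bipartite tournament between two `n`-team leagues: the games that are played
on each of the `2n` consecutive days. -/
abbrev Schedule (n : ℕ) (X Y : Type*) := Fin (2 * n) → Set (Game X Y)

/-- A feasible solution of BTTP: a double round-robin bipartite tournament on `2n` days which
satisfies the no-repeat and the bounded-by-3 constraints. -/
structure IsFeasible {n : ℕ} {X Y : Type*} (S : Schedule n X Y) : Prop where
  /-- On each day each team of the first league plays exactly one game. -/
  one_game_x : ∀ (t : Fin (2 * n)) (x : X), ∃! g, g ∈ S t ∧ g.x = x
  /-- On each day each team of the second league plays exactly one game. -/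
  one_game_y : ∀ (t : Fin (2 * n)) (y : Y), ∃! g, g ∈ S t ∧ g.y = y
  /-- Any `x` and `y` play exactly once at the home of `x` and exactly once at the home of `y`. -/
  double_round_robin : ∀ g : Game X Y, ∃! t, g ∈ S t
  /-- No pair of teams meets on two consecutive days. -/
  no_repeat : ∀ t t' : Fin (2 * n), (t' : ℕ) = t + 1 → ∀ g ∈ S t, ∀ g' ∈ S t',
    ¬ (g.x = g'.x ∧ g.y = g'.y)
  /-- No team of the first league plays four consecutive home games or away games. -/
  bounded_by_three_x : ∀ (x : X) (v : Venue) (t : ℕ) (ht : t + 3 < 2 * n),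
    ¬ ∀ i : Fin 4, ∃ g ∈ S ⟨t + i, by omega⟩, g.x = x ∧ g.venue = v
  /-- No team of the second league plays four consecutive home games or away games. -/
  bounded_by_three_y : ∀ (y : Y) (v : Venue) (t : ℕ) (ht : t + 3 < 2 * n),
    ¬ ∀ i : Fin 4, ∃ g ∈ S ⟨t + i, by omega⟩, g.y = y ∧ g.venue = v

/-! ### Sets of games between labels

In the construction a team is represented by its label: the label `a` stands for the team `x_a`
in the first component of a game, and for the team `y_a` in the second component. -/

/-- A set of games between labelled teams. -/
abbrev Games := Finset (Game ℕ ℕ)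

/-- The set of games with all venues reversed (written with an overline in mathematical text). -/
def bar (A : Games) : Games := A.image Game.rev

/-- `A` if `k` is even, and `A` with reversed venues if `k` is odd. -/
def alt (k : ℕ) (A : Games) : Games := if Even k then A else bar A

/-- The set of games `m_i = {s_k → t_((k + i) mod N) : 0 ≤ k < N}`. -/
def shiftMatching (N : ℕ) (s t : ℕ → ℕ) (i : ℕ) : Games :=
  (Finset.range N).image fun k => away (s k) (t ((k + i) % N))

/-! ### Extending super-games into regular games -/

/-- Day `r` (`0 ≤ r < 6d`) of the normal super-game between the super-teams
`{s_0, …, s_(3d-1)}` and `{t_0, …, t_(3d-1)}`. -/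
def normalDay (d : ℕ) (s t : ℕ → ℕ) (r : ℕ) : Games :=
  (Finset.range d ×ˢ Finset.range d ×ˢ Finset.range 3 ×ˢ Finset.range 3).biUnion
    fun (i, j, i', j') =>
      (if r = (6 * (i + j) + i' + j') % (6 * d)
        then {away (s (3 * i + i')) (t (3 * j + j'))} else ∅) ∪
      (if r = (6 * (i + j) + i' + j' + 3) % (6 * d)
        then {(away (s (3 * i + i')) (t (3 * j + j'))).rev} else ∅)

/-- Day `r` (`0 ≤ r < 6d`) of the left super-game between the super-teams
`{s_0, …, s_(3d-1)}` and `{t_0, …, t_(3d-1)}` with the team-pair `{s_(3d), t_(3d)}`.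
Writing `-m` for `m` with reversed venues, the days are
`m_1, -m_2, m_3, …, -m_(3d), m_2, -m_3, m_4, …, m_(3d), -m_1` if `d` is even, and
`m_1, -m_2, m_3, …, m_(3d), -m_1, m_2, -m_3, …, -m_(3d)` if `d` is odd. -/
def leftDay (d : ℕ) (s t : ℕ → ℕ) (r : ℕ) : Games :=
  let M := shiftMatching (3 * d + 1) s t
  if r < 3 * d then alt r (M (r + 1))
  else
    let q := r - 3 * d
    if Even d then alt q (M (if q + 1 < 3 * d then q + 2 else 1))
    else bar (alt q (M (q + 1)))

/-! ### The 3-path construction with parameters `m` and `d`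

Throughout, `l = n - 3md` is the number of team-pairs. Super-teams, team-pairs, positions and
time slots are numbered from `0`. -/

/-- The label of the `k`-th team of the `i`-th super-team of a league; for `k = 3d` the label of
the team of the team-pair `p`. -/
def teamLabel (m d p i : ℕ) (k : ℕ) : ℕ :=
  if k < 3 * d then 3 * d * i + k else 3 * m * d + p

/-- The super-team of the first league at position `p` in time slot `τ`: from each time slot to
the next these super-teams take one leftward shift. -/
def superX (m τ p : ℕ) : ℕ := (p + τ) % m

/-- The super-team of the second league at position `p` in time slot `τ`: from each time slot to
the next these super-teams take two leftward shifts. -/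
def superY (m τ p : ℕ) : ℕ := (p + 2 * τ) % m

/-- The games on day `r` of time slot `τ < m` of the super-game at position `p`: a left super-game
with team-pair `p` if `p < l`, and a normal super-game otherwise. -/
def superGameDay (n m d τ p r : ℕ) : Games :=
  let s := teamLabel m d p (superX m τ p)
  let t := teamLabel m d p (superY m τ p)
  if p < n - 3 * m * d then leftDay d s t r else normalDay d s t r

/-- The games on day `r` of time slot `τ < m`. -/
def slotDay (n m d τ r : ℕ) : Games :=
  (Finset.range m).biUnion fun p => superGameDay n m d τ p r

/-- The games `m_i` of the last time slot between the teams in team-pairs. -/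
def pairGames (n m d i : ℕ) : Games :=
  shiftMatching (n - 3 * m * d) (fun k => 3 * m * d + k) (fun k => 3 * m * d + k) i

/-- The games `M_p` of the last time slot: the games `s_k → t_k` (`k < 3d`) between teams in
super-teams that were left out in the left super-games with team-pair `p`. -/
def leftOverGames (m d p : ℕ) : Games :=
  (Finset.range m).biUnion fun τ => (Finset.range (3 * d)).image fun k =>
    away (teamLabel m d p (superX m τ p) k) (teamLabel m d p (superY m τ p) k)

/-- The games on day `r` (`0 ≤ r < 2l`) of the last time slot. With `A_i` the union of the `i`-th
games of team-pairs and the `i`-th left over games, the days are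
`A_0, -A_1, A_2, -A_3, …` (`l` days), followed by the same `l` days with all venues reversed. -/
def lastSlotDay (n m d r : ℕ) : Games :=
  let l := n - 3 * m * d
  let A := fun i => pairGames n m d i ∪ leftOverGames m d i
  if r < l then alt r (A r) else bar (alt (r - l) (A (r - l)))

/-- The games on day `t` (`0 ≤ t < 2n`) of the 3-path construction: `m` time slots of `6d` days,
followed by the last time slot of `2l` days. -/
def constructionDay (n m d t : ℕ) : Games :=
  if t < 6 * m * d then slotDay n m d (t / (6 * d)) (t % (6 * d))
  else lastSlotDay n m d (t - 6 * m * d)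

/-- The games on day `t` of the modified 3-path construction: if `l = 1` then the days
`g_1 g_2 … g_(2n)` of the 3-path construction are rearranged as `g_(2n) g_1 … g_(2n-1)`. -/
def newConstructionDay (n m d t : ℕ) : Games :=
  if n - 3 * m * d = 1 then constructionDay n m d ((t + (2 * n - 1)) % (2 * n))
  else constructionDay n m d t

/-- The schedule of the modified 3-path construction, when the teams of the two leagues are
labelled by `0, …, n-1` by `labX` and `labY`. The 3-paths used are the triples of teams labelled
`3i, 3i+1, 3i+2` with `i < md`; as the labellings are arbitrary bijections, these are arbitrary
sequences of `md` disjoint triples. -/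
def newConstruction (n m d : ℕ) {X Y : Type*} (labX : X ≃ Fin n) (labY : Y ≃ Fin n) :
    Schedule n X Y :=
  fun t => {g | (⟨labX g.x, labY g.y, g.venue⟩ : Game ℕ ℕ) ∈ newConstructionDay n m d t}

/-- The parameters `m` (number of super-teams in a league) and `d` (number of 3-paths in a
super-team) that the construction may use for `n`: both positive, `m` odd, `3md ≤ n`, and the
number `l = n - 3md` of team-pairs is at most `m`. -/
def Admissible (n m d : ℕ) : Prop :=
  0 < d ∧ Odd m ∧ 3 * m * d ≤ n ∧ n - 3 * m * d ≤ m

end BTTP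

namespace BTTP

/-! ### Admissible parameters -/

/-! Feasibility reduces by counting to two weaker facts: every game is played on some day
(`exists_day`), and no team plays twice on a day (`constructionDay_right_unique`,
`constructionDay_left_unique`). There are as many games as pairs (day, team of one league), so an
injection from games to such pairs is a bijection, and "at least" and "at most" become "exactly"
(`existsUnique_of_card_eq`).

Both facts rest on arithmetic modulo `m`. At position `p` in slot `τ` stand the super-teams `p + τ`
and `p + 2τ`. Their difference gives `τ`, so two super-teams meet exactly once. For fixed `p` each
super-team passes exactly once, in the second league because 2 is invertible modulo the odd `m`.
Hence two teams that are not both in team-pairs share a position in one slot only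
(`encounter_unique`). A left super-game leaves out exactly the pairs with equal index, and these
fill the last slot.

No-repeat is then checked inside one slot (`SuperMeets.not_succ`) and inside the last slot, where
only `l = 1` fails, with `A_0` next to its reversal; the rotation repairs this.

For bounded-by-3, the venue of a team depends only on the day, its label modulo 3 and the kind of
super-game it is in (`VenuePattern`). The days before the last slot split into blocks of six, either
alternating from `Y` or running `YYYXXX` delayed by the label modulo 3. Every block ends at `X` and
delays are at most 2, so no run exceeds three. -/

theorem exists_admissible_iff (n : ℕ) (hn : 1 ≤ n) :
    (∃ m d : ℕ, Admissible n m d) ↔ n ∉ ({1, 2, 5, 8, 14} : Set ℕ) := by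
  simp only [Set.mem_insert_iff, Set.mem_singleton_iff, not_or, Admissible]
  constructor
  · rintro ⟨m, d, hd, ⟨c, rfl⟩, hle, hl⟩
    have h3 : 3 * (2 * c + 1) ≤ 3 * (2 * c + 1) * d := Nat.le_mul_of_pos_right _ hd
    refine ⟨by omega, by omega, ?_, ?_, ?_⟩ <;> rintro rfl <;>
      -- Since `3m ≤ n ≤ 14`, only `m = 1` and `m = 3` remain.
      (have hc : c ≤ 1 := by omega
       interval_cases c <;> omega)
  · rintro ⟨h1, h2, h5, h8, h14⟩
    obtain ⟨a, h | h | h⟩ : ∃ a, n = 3 * a ∨ n = 3 * a + 1 ∨ n = 3 * a + 2 := ⟨n / 3, by omega⟩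
    · exact ⟨1, a, by omega, odd_one, by omega, by omega⟩
    · exact ⟨1, a, by omega, odd_one, by omega, by omega⟩
    -- With `d = 1`, even `a` gives `m = a - 1` and `l = 5`, which fails for `a = 0, 2, 4`; odd `a`
    -- gives `m = a` and `l = 2`, which fails for `a = 1`. These are the exceptions 2, 8, 14 and 5.
    · rcases Nat.even_or_odd a with ⟨b, hb⟩ | ha
      · exact ⟨a - 1, 1, one_pos, ⟨b - 1, by omega⟩, by omega, by omega⟩
      · exact ⟨a, 1, one_pos, ha, by omega, by obtain ⟨b, hb⟩ := ha; omega⟩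

theorem Venue.eq_of_iff {v w : Venue} {P : Prop} (hv : v = .Y ↔ P) (hw : w = .Y ↔ P) : v = w := by
  cases v <;> cases w <;> simp_all

/-! ### Membership in the days of super-games -/

/-- Makes a residue modulo a symbolic number piecewise linear, hence open to `omega`. The bound
suffices throughout: an extreme case is `p + 2τ < 3m`. -/
theorem mod_eq_of_lt_three_mul {x m : ℕ} (h : x < 3 * m) :
    x % m = if x < m then x else if x < 2 * m then x - m else x - 2 * m := by
  split_ifs with h1 h2
  · exact Nat.mod_eq_of_lt h1
  · rw [Nat.mod_eq_sub_mod (by omega), Nat.mod_eq_of_lt (by omega)]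
  · rw [Nat.mod_eq_sub_mod (by omega), Nat.mod_eq_sub_mod (by omega), Nat.mod_eq_of_lt (by omega)]
    omega

theorem mem_bar {A : Games} {a b : ℕ} {v : Venue} :
    (⟨a, b, v⟩ : Game ℕ ℕ) ∈ bar A ↔ ⟨a, b, v.swap⟩ ∈ A := by
  simp only [bar, Finset.mem_image]
  constructor
  · rintro ⟨⟨x, y, w⟩, hg, h⟩
    cases w <;> cases v <;> simp_all [Game.rev, Venue.swap]
  · intro h
    exact ⟨_, h, by cases v <;> rfl⟩

theorem mem_alt {A : Games} {P : ℕ → ℕ → Prop}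
    (hA : ∀ a b v, (⟨a, b, v⟩ : Game ℕ ℕ) ∈ A ↔ P a b ∧ v = .Y) {a b q : ℕ} {v : Venue} :
    (⟨a, b, v⟩ : Game ℕ ℕ) ∈ alt q A ↔ P a b ∧ (v = .Y ↔ Even q) := by
  unfold alt
  split_ifs with h
  · simp [hA, h]
  · rw [mem_bar, hA]
    cases v <;> simp [h, Venue.swap]

theorem mem_bar_alt {A : Games} {P : ℕ → ℕ → Prop}
    (hA : ∀ a b v, (⟨a, b, v⟩ : Game ℕ ℕ) ∈ A ↔ P a b ∧ v = .Y) {a b q : ℕ} {v : Venue} :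
    (⟨a, b, v⟩ : Game ℕ ℕ) ∈ bar (alt q A) ↔ P a b ∧ (v = .Y ↔ ¬ Even q) := by
  rw [mem_bar, mem_alt hA]
  cases v <;> simp [Venue.swap]

theorem mem_shiftMatching {N i : ℕ} {s t : ℕ → ℕ} (a b : ℕ) (v : Venue) :
    (⟨a, b, v⟩ : Game ℕ ℕ) ∈ shiftMatching N s t i ↔
      (∃ k k', k < N ∧ k' = (k + i) % N ∧ a = s k ∧ b = t k') ∧ v = .Y := by
  simp only [shiftMatching, Finset.mem_image, Finset.mem_range, away, Game.mk.injEq]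
  constructor
  · rintro ⟨k, hk, rfl, rfl, rfl⟩
    exact ⟨⟨k, _, hk, rfl, rfl, rfl⟩, rfl⟩
  · rintro ⟨⟨k, _, hk, rfl, rfl, rfl⟩, rfl⟩
    exact ⟨k, hk, rfl, rfl, rfl⟩

/-- The index of the matching that is played on day `r` of a left super-game. -/
def leftShift (d r : ℕ) : ℕ :=
  if r < 3 * d then r + 1
  else if Even d then (if r - 3 * d + 1 < 3 * d then r - 3 * d + 2 else 1)
  else r - 3 * d + 1

/-- On day `r` of a super-game the teams with numbers `k` and `k'` in their super-teams meet at
venue `v`; the super-game is a left one if `isLeft` holds and a normal one otherwise. -/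
def SuperMeets (d : ℕ) (isLeft : Prop) (r k k' : ℕ) (v : Venue) : Prop :=
  (isLeft ∧ k < 3 * d + 1 ∧ k' = (k + leftShift d r) % (3 * d + 1) ∧ (v = .Y ↔ Even r)) ∨
  (¬ isLeft ∧ k < 3 * d ∧ k' < 3 * d ∧
    ((v = .Y ∧ r = (6 * (k / 3 + k' / 3) + k % 3 + k' % 3) % (6 * d)) ∨
     (v = .X ∧ r = (6 * (k / 3 + k' / 3) + k % 3 + k' % 3 + 3) % (6 * d))))

/-- The two orders of days merge into one rule: the venue alternates with the parity of `r` over all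
`6d` days. The second half starts at `3d`, which is even for even `d`; for odd `d` the extra
reversal makes up for the odd start. -/
theorem mem_leftDay {d r a b : ℕ} {s t : ℕ → ℕ} {v : Venue} :
    (⟨a, b, v⟩ : Game ℕ ℕ) ∈ leftDay d s t r ↔
      ∃ k k', a = s k ∧ b = t k' ∧ SuperMeets d True r k k' v := by
  have key : (⟨a, b, v⟩ : Game ℕ ℕ) ∈ leftDay d s t r ↔
      (∃ k k', k < 3 * d + 1 ∧ k' = (k + leftShift d r) % (3 * d + 1) ∧ a = s k ∧ b = t k') ∧
        (v = .Y ↔ Even r) := by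
    unfold leftDay leftShift
    dsimp only
    split_ifs with h1 h2 h3
    · rw [mem_alt mem_shiftMatching]
    · rw [mem_alt mem_shiftMatching]
      have : Even (r - 3 * d) ↔ Even r := by
        simp only [Nat.even_iff] at h2 ⊢; omega
      rw [this]
    · rw [mem_alt mem_shiftMatching]
      have : Even (r - 3 * d) ↔ Even r := by
        simp only [Nat.even_iff] at h2 ⊢; omega
      rw [this]
    · rw [mem_bar_alt mem_shiftMatching]
      have : ¬ Even (r - 3 * d) ↔ Even r := by
        simp only [Nat.even_iff] at h2 ⊢; omega
      rw [this]
  rw [key]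
  simp only [SuperMeets, true_and, not_true_eq_false, false_and, or_false]
  constructor
  · rintro ⟨⟨k, k', h1, h2, h3, h4⟩, h5⟩
    exact ⟨k, k', h3, h4, h1, h2, h5⟩
  · rintro ⟨k, k', h3, h4, h1, h2, h5⟩
    exact ⟨⟨k, k', h1, h2, h3, h4⟩, h5⟩

theorem mem_normalDay {d r a b : ℕ} {s t : ℕ → ℕ} {v : Venue} :
    (⟨a, b, v⟩ : Game ℕ ℕ) ∈ normalDay d s t r ↔
      ∃ k k', a = s k ∧ b = t k' ∧ SuperMeets d False r k k' v := by
  simp only [normalDay, Finset.mem_biUnion, Finset.mem_product, Finset.mem_range, Finset.mem_union,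
    SuperMeets, false_and, false_or, not_false_eq_true, true_and]
  constructor
  · rintro ⟨⟨i, j, i', j'⟩, ⟨hi, hj, hi', hj'⟩, h⟩
    dsimp only at hi hj hi' hj' h
    have e1 : (3 * i + i') / 3 = i := by omega
    have e2 : (3 * i + i') % 3 = i' := by omega
    have e3 : (3 * j + j') / 3 = j := by omega
    have e4 : (3 * j + j') % 3 = j' := by omega
    refine ⟨3 * i + i', 3 * j + j', ?_⟩
    rw [e1, e2, e3, e4]
    rcases h with h | h <;> split_ifs at h with hr
    · simp only [away, Finset.mem_singleton, Game.mk.injEq] at h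
      exact ⟨h.1, h.2.1, by omega, by omega, .inl ⟨h.2.2, hr⟩⟩
    · simp at h
    · simp only [away, Game.rev, Venue.swap, Finset.mem_singleton, Game.mk.injEq] at h
      exact ⟨h.1, h.2.1, by omega, by omega, .inr ⟨h.2.2, hr⟩⟩
    · simp at h
  · rintro ⟨k, k', rfl, rfl, hk, hk', h⟩
    refine ⟨(k / 3, k' / 3, k % 3, k' % 3), ⟨?_, ?_, ?_, ?_⟩, ?_⟩
    iterate 4 dsimp only; omega
    dsimp only
    rw [Nat.div_add_mod, Nat.div_add_mod]
    rcases h with ⟨rfl, h⟩ | ⟨rfl, h⟩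
    · left; rw [if_pos h]; simp [away]
    · right; rw [if_pos h]; simp [away, Game.rev, Venue.swap]

namespace SuperMeets

variable {d r k k' k₁ k₁' : ℕ} {L : Prop} {v w : Venue}

theorem lt (h : SuperMeets d L r k k' v) :
    k < 3 * d + 1 ∧ k' < 3 * d + 1 ∧ (¬ L → k < 3 * d ∧ k' < 3 * d) := by
  rcases h with ⟨hL, h1, rfl, -⟩ | ⟨hL, h1, h2, -⟩
  · exact ⟨h1, Nat.mod_lt _ (by omega), fun h => absurd hL h⟩
  · exact ⟨by omega, by omega, fun _ => ⟨h1, h2⟩⟩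

theorem leftShift_mem (hr : r < 6 * d) : 1 ≤ leftShift d r ∧ leftShift d r ≤ 3 * d := by
  unfold leftShift
  split_ifs <;> omega

theorem ne (hr : r < 6 * d) (hL : L) (h : SuperMeets d L r k k' v) : k ≠ k' := by
  rcases h with ⟨-, h1, rfl, -⟩ | ⟨h, -⟩
  · have := leftShift_mem hr
    rw [mod_eq_of_lt_three_mul (by omega)]
    split_ifs <;> omega
  · exact absurd hL h

/-- In a normal super-game `r` is congruent modulo 6 to `k % 3 + k' % 3`, plus 3 for the reversed
venue. As each residue is at most 2, subtracting either one leaves 0, 1, 2 for `Y` and 3, 4, 5 for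
`X`, whoever the opponent is. -/
theorem venue (h : SuperMeets d L r k k' v) :
    (L → (v = .Y ↔ r % 2 = 0)) ∧ (¬ L → (v = .Y ↔ (r + (6 - k % 3)) % 6 < 3)) ∧
      (¬ L → (v = .Y ↔ (r + (6 - k' % 3)) % 6 < 3)) := by
  rcases h with ⟨hL, h1, rfl, h⟩ | ⟨hL, h1, h2, h⟩
  · rw [Nat.even_iff] at h
    exact ⟨fun _ => h, fun h => absurd hL h, fun h => absurd hL h⟩
  · refine ⟨fun h => absurd h hL, fun _ => ?_, fun _ => ?_⟩ <;>
    · rcases h with ⟨rfl, h⟩ | ⟨rfl, h⟩ <;> rw [mod_eq_of_lt_three_mul (by omega)] at h <;>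
        simp only [reduceCtorEq, true_iff, false_iff] <;> split_ifs at h <;> omega

theorem right_unique (hr : r < 6 * d) (h : SuperMeets d L r k k' v)
    (h₁ : SuperMeets d L r k k₁' w) : k' = k₁' ∧ v = w := by
  rcases h with ⟨hL, a1, a2, a3⟩ | ⟨hL, a1, a2, a3⟩
  · rcases h₁ with ⟨-, b1, b2, b3⟩ | ⟨hL', -⟩
    · exact ⟨by rw [a2, b2], Venue.eq_of_iff a3 b3⟩
    · exact absurd hL hL'
  · rcases h₁ with ⟨hL', -⟩ | ⟨-, b1, b2, b3⟩
    · exact absurd hL' hL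
    · rcases a3 with ⟨rfl, a⟩ | ⟨rfl, a⟩ <;> rcases b3 with ⟨rfl, b⟩ | ⟨rfl, b⟩ <;>
        rw [mod_eq_of_lt_three_mul (by omega)] at a b <;>
        simp only [reduceCtorEq, and_false, and_true] <;>
        split_ifs at a b <;> omega

theorem left_unique (hr : r < 6 * d) (h : SuperMeets d L r k k' v)
    (h₁ : SuperMeets d L r k₁ k' w) : k = k₁ ∧ v = w := by
  rcases h with ⟨hL, a1, a2, a3⟩ | ⟨hL, a1, a2, a3⟩
  · rcases h₁ with ⟨-, b1, b2, b3⟩ | ⟨hL', -⟩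
    · refine ⟨?_, Venue.eq_of_iff a3 b3⟩
      have := leftShift_mem hr
      rw [mod_eq_of_lt_three_mul (by omega)] at a2 b2
      split_ifs at a2 b2 <;> omega
    · exact absurd hL hL'
  · rcases h₁ with ⟨hL', -⟩ | ⟨-, b1, b2, b3⟩
    · exact absurd hL' hL
    · rcases a3 with ⟨rfl, a⟩ | ⟨rfl, a⟩ <;> rcases b3 with ⟨rfl, b⟩ | ⟨rfl, b⟩ <;>
        rw [mod_eq_of_lt_three_mul (by omega)] at a b <;>
        simp only [reduceCtorEq, and_false, and_true] <;>
        split_ifs at a b <;> omega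

/-- In a left super-game consecutive days use different shifts, also where the halves join. In a
normal one the two games of a pair are on days that differ by 3 modulo 6. -/
theorem not_succ (hr : r + 1 < 6 * d) (h : SuperMeets d L r k k' v) :
    ¬ SuperMeets d L (r + 1) k k' w := by
  intro h₁
  rcases h with ⟨hL, a1, a2, -⟩ | ⟨hL, a1, a2, a3⟩
  · rcases h₁ with ⟨-, b1, b2, -⟩ | ⟨hL', -⟩
    · have h1 := leftShift_mem (d := d) (r := r) (by omega)
      have h2 := leftShift_mem hr
      have h3 : leftShift d r ≠ leftShift d (r + 1) := by
        unfold leftShift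
        simp only [Nat.even_iff]
        split_ifs <;> omega
      rw [mod_eq_of_lt_three_mul (by omega)] at a2 b2
      split_ifs at a2 b2 <;> omega
    · exact absurd hL hL'
  · rcases h₁ with ⟨hL', -⟩ | ⟨-, b1, b2, b3⟩
    · exact absurd hL' hL
    · rcases a3 with ⟨-, a⟩ | ⟨-, a⟩ <;> rcases b3 with ⟨-, b⟩ | ⟨-, b⟩ <;>
        rw [mod_eq_of_lt_three_mul (by omega)] at a b <;>
        split_ifs at a b <;> omega

theorem exists_day_of_left (hL : L) (hk : k ≤ 3 * d) (hk' : k' ≤ 3 * d) (hne : k ≠ k')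
    (v : Venue) : ∃ r < 6 * d, SuperMeets d L r k k' v := by
  obtain ⟨i, hi1, hi, hki⟩ : ∃ i, 1 ≤ i ∧ i ≤ 3 * d ∧ k' = (k + i) % (3 * d + 1) := by
    rcases lt_or_gt_of_ne hne with h | h
    · exact ⟨k' - k, by omega, by omega, by rw [mod_eq_of_lt_three_mul (by omega)]; split_ifs <;> omega⟩
    · exact ⟨3 * d + 1 + k' - k, by omega, by omega,
        by rw [mod_eq_of_lt_three_mul (by omega)]; split_ifs <;> omega⟩
  obtain ⟨r, hr, hri, hrv⟩ : ∃ r < 6 * d, leftShift d r = i ∧ (v = .Y ↔ Even r) := by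
    have h1 : leftShift d (i - 1) = i := by
      unfold leftShift; rw [if_pos (by omega)]; omega
    -- Shift `i` recurs in the second half on a day of the other parity, hence at the other venue.
    -- For even `d` this needs the half to start with shift 2, which sends shift 1 to the final day.
    obtain ⟨r, hr, hri, hrv⟩ : ∃ r < 6 * d, leftShift d r = i ∧ (Even r ↔ ¬ Even (i - 1)) := by
      rcases Nat.even_or_odd d with hd | hd
      · by_cases h : i = 1
        · refine ⟨6 * d - 1, by omega, ?_, ?_⟩
          · unfold leftShift; rw [if_neg (by omega), if_pos hd, if_neg (by omega), h]
          · simp only [Nat.even_iff]; omega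
        · refine ⟨3 * d + i - 2, by omega, ?_, ?_⟩
          · unfold leftShift; rw [if_neg (by omega), if_pos hd, if_pos (by omega)]; omega
          · simp only [Nat.even_iff] at hd ⊢; omega
      · refine ⟨3 * d + i - 1, by omega, ?_, ?_⟩
        · unfold leftShift; rw [if_neg (by omega), if_neg (by simpa using hd)]; omega
        · rw [Nat.odd_iff] at hd; simp only [Nat.even_iff]; omega
    by_cases h : v = .Y ↔ Even (i - 1)
    · exact ⟨i - 1, by omega, h1, h⟩
    · exact ⟨r, hr, hri, by tauto⟩
  exact ⟨r, hr, .inl ⟨hL, by omega, by rw [hri, hki], hrv⟩⟩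

theorem exists_day_of_not_left (hL : ¬ L) (hk : k < 3 * d) (hk' : k' < 3 * d) (v : Venue) :
    ∃ r < 6 * d, SuperMeets d L r k k' v := by
  cases v
  · exact ⟨_, Nat.mod_lt _ (by omega), .inr ⟨hL, hk, hk', .inr ⟨rfl, rfl⟩⟩⟩
  · exact ⟨_, Nat.mod_lt _ (by omega), .inr ⟨hL, hk, hk', .inl ⟨rfl, rfl⟩⟩⟩

end SuperMeets

/-! ### Labels, positions and encounters of super-teams -/

section Labels

variable {n m d p p₁ τ τ₁ i i₁ k k' k₁ k₁' a : ℕ}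

theorem teamLabel_of_lt (hk : k < 3 * d) : teamLabel m d p i k = 3 * d * i + k := if_pos hk

theorem teamLabel_of_le (hk : 3 * d ≤ k) : teamLabel m d p i k = 3 * m * d + p :=
  if_neg (by omega)

theorem super_label_lt (hi : i < m) (hk : k < 3 * d) : 3 * d * i + k < 3 * m * d := by
  have : 3 * d * (i + 1) ≤ 3 * d * m := Nat.mul_le_mul_left _ hi
  have h : 3 * m * d = 3 * d * m := by ring
  rw [h]
  rw [mul_add] at this
  omega

theorem teamLabel_mod_three (hk : k < 3 * d) : teamLabel m d p i k % 3 = k % 3 := by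
  rw [teamLabel_of_lt hk, mul_assoc, Nat.mul_add_mod]

theorem teamLabel_inj (hi : i < m) (hi₁ : i₁ < m) (hk : k < 3 * d + 1) (hk₁ : k₁ < 3 * d + 1)
    (h : teamLabel m d p i k = teamLabel m d p₁ i₁ k₁) :
    k = k₁ ∧ (k < 3 * d → i = i₁) ∧ (k = 3 * d → p = p₁) := by
  rcases Nat.lt_or_ge k (3 * d) with hk' | hk' <;> rcases Nat.lt_or_ge k₁ (3 * d) with hk₁' | hk₁'
  · rw [teamLabel_of_lt hk', teamLabel_of_lt hk₁'] at h
    have e := congrArg (· % (3 * d)) h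
    simp only [Nat.mul_add_mod, Nat.mod_eq_of_lt hk', Nat.mod_eq_of_lt hk₁'] at e
    subst e
    exact ⟨rfl, fun _ => Nat.eq_of_mul_eq_mul_left (by omega : 0 < 3 * d) (by omega), by omega⟩
  · rw [teamLabel_of_lt hk', teamLabel_of_le hk₁'] at h
    have := super_label_lt hi hk'
    omega
  · rw [teamLabel_of_le hk', teamLabel_of_lt hk₁'] at h
    have := super_label_lt hi₁ hk₁'
    omega
  · rw [teamLabel_of_le hk', teamLabel_of_le hk₁'] at h
    omega

theorem exists_label (h : 3 * m * d ≤ n) (ha : a < n) :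
    (∃ i < m, ∃ k < 3 * d, ∀ p, a = teamLabel m d p i k) ∨
      ∃ p < n - 3 * m * d, a = 3 * m * d + p := by
  rcases Nat.lt_or_ge a (3 * m * d) with h' | h'
  · have h2 : a < 3 * d * m := by rwa [show 3 * d * m = 3 * m * d by ring]
    have hd : 0 < 3 * d := Nat.pos_of_ne_zero fun h0 => by rw [h0] at h2; omega
    refine .inl ⟨a / (3 * d), Nat.div_lt_of_lt_mul h2, a % (3 * d), Nat.mod_lt _ hd, fun p => ?_⟩
    rw [teamLabel_of_lt (Nat.mod_lt _ hd), Nat.div_add_mod]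
  · exact .inr ⟨a - 3 * m * d, by omega, by omega⟩

theorem superX_lt (hm : 0 < m) : superX m τ p < m := Nat.mod_lt _ hm

theorem superY_lt (hm : 0 < m) : superY m τ p < m := Nat.mod_lt _ hm

theorem superX_eq (hτ : τ < m) (hp : p < m) :
    superX m τ p = if p + τ < m then p + τ else p + τ - m := by
  unfold superX
  rw [mod_eq_of_lt_three_mul (by omega)]
  split_ifs <;> omega

theorem superY_eq (hτ : τ < m) (hp : p < m) :
    superY m τ p = if p + 2 * τ < m then p + 2 * τ else
      if p + 2 * τ < 2 * m then p + 2 * τ - m else p + 2 * τ - 2 * m := by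
  unfold superY
  rw [mod_eq_of_lt_three_mul (by omega)]

theorem position_unique_x (hτ : τ < m) (hp : p < m) (hp₁ : p₁ < m) (hk : k < 3 * d + 1)
    (hk₁ : k₁ < 3 * d + 1)
    (h : teamLabel m d p (superX m τ p) k = teamLabel m d p₁ (superX m τ p₁) k₁) :
    p = p₁ ∧ k = k₁ := by
  obtain ⟨h1, h2, h3⟩ := teamLabel_inj (superX_lt (by omega)) (superX_lt (by omega)) hk hk₁ h
  refine ⟨?_, h1⟩
  rcases Nat.lt_or_ge k (3 * d) with hk' | hk'
  · have h := h2 hk'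
    rw [superX_eq hτ hp, superX_eq hτ hp₁] at h
    split_ifs at h <;> omega
  · exact h3 (by omega)

theorem position_unique_y (hτ : τ < m) (hp : p < m) (hp₁ : p₁ < m) (hk : k < 3 * d + 1)
    (hk₁ : k₁ < 3 * d + 1)
    (h : teamLabel m d p (superY m τ p) k = teamLabel m d p₁ (superY m τ p₁) k₁) :
    p = p₁ ∧ k = k₁ := by
  obtain ⟨h1, h2, h3⟩ := teamLabel_inj (superY_lt (by omega)) (superY_lt (by omega)) hk hk₁ h
  refine ⟨?_, h1⟩
  rcases Nat.lt_or_ge k (3 * d) with hk' | hk'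
  · have h := h2 hk'
    rw [superY_eq hτ hp, superY_eq hτ hp₁] at h
    split_ifs at h <;> omega
  · exact h3 (by omega)

theorem slot_unique_x (hτ : τ < m) (hτ₁ : τ₁ < m) (hp : p < m)
    (h : superX m τ p = superX m τ₁ p) : τ = τ₁ := by
  rw [superX_eq hτ hp, superX_eq hτ₁ hp] at h
  split_ifs at h <;> omega

/-- Cancels 2 modulo `m`, which requires `m` to be odd. -/
theorem slot_unique_y (hm : Odd m) (hτ : τ < m) (hτ₁ : τ₁ < m) (hp : p < m)
    (h : superY m τ p = superY m τ₁ p) : τ = τ₁ := by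
  rw [superY_eq hτ hp, superY_eq hτ₁ hp] at h
  obtain ⟨c, rfl⟩ := hm
  split_ifs at h <;> omega

theorem slot_position_unique (hτ : τ < m) (hτ₁ : τ₁ < m) (hp : p < m) (hp₁ : p₁ < m)
    (hx : superX m τ p = superX m τ₁ p₁) (hy : superY m τ p = superY m τ₁ p₁) :
    τ = τ₁ ∧ p = p₁ := by
  rw [superX_eq hτ hp, superX_eq hτ₁ hp₁] at hx
  rw [superY_eq hτ hp, superY_eq hτ₁ hp₁] at hy
  split_ifs at hx hy <;> omega

/-- Two teams which do not both belong to team-pairs share the position in one slot only. -/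
theorem encounter_unique (hm : Odd m) (hτ : τ < m) (hτ₁ : τ₁ < m) (hp : p < m) (hp₁ : p₁ < m)
    (hk : k < 3 * d + 1) (hk' : k' < 3 * d + 1) (hk₁ : k₁ < 3 * d + 1) (hk₁' : k₁' < 3 * d + 1)
    (hne : k < 3 * d ∨ k' < 3 * d)
    (hx : teamLabel m d p (superX m τ p) k = teamLabel m d p₁ (superX m τ₁ p₁) k₁)
    (hy : teamLabel m d p (superY m τ p) k' = teamLabel m d p₁ (superY m τ₁ p₁) k₁') :
    τ = τ₁ ∧ p = p₁ ∧ k = k₁ ∧ k' = k₁' := by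
  obtain ⟨x1, x2, x3⟩ := teamLabel_inj (superX_lt (by omega)) (superX_lt (by omega)) hk hk₁ hx
  obtain ⟨y1, y2, y3⟩ := teamLabel_inj (superY_lt (by omega)) (superY_lt (by omega)) hk' hk₁' hy
  have key : τ = τ₁ ∧ p = p₁ := by
    rcases Nat.lt_or_ge k (3 * d) with h | h
    · rcases Nat.lt_or_ge k' (3 * d) with h' | h'
      · exact slot_position_unique hτ hτ₁ hp hp₁ (x2 h) (y2 h')
      · obtain rfl := y3 (by omega)
        exact ⟨slot_unique_x hτ hτ₁ hp (x2 h), rfl⟩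
    · obtain rfl := x3 (by omega)
      exact ⟨slot_unique_y hm hτ hτ₁ hp (y2 (by omega)), rfl⟩
  exact ⟨key.1, key.2, x1, y1⟩

theorem exists_slot_x (hp : p < m) (hi : i < m) : ∃ τ < m, superX m τ p = i := by
  rcases Nat.lt_or_ge i p with h | h
  · refine ⟨i + m - p, by omega, ?_⟩
    rw [superX_eq (by omega) hp]; split_ifs <;> omega
  · refine ⟨i - p, by omega, ?_⟩
    rw [superX_eq (by omega) hp]; split_ifs <;> omega

theorem exists_slot_y (hm : Odd m) (hp : p < m) (hi : i < m) : ∃ τ < m, superY m τ p = i := by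
  obtain ⟨q, hq, e⟩ : ∃ q < m, q + p = i ∨ q + p = i + m := by
    rcases Nat.lt_or_ge i p with h | h
    · exact ⟨i + m - p, by omega, by omega⟩
    · exact ⟨i - p, by omega, by omega⟩
  obtain ⟨c, rfl⟩ := hm
  -- Solve `2τ ≡ q` modulo `m`: whichever of `q` and `q + m` is even gets halved.
  rcases Nat.even_or_odd q with hq' | hq'
  · rw [Nat.even_iff] at hq'
    refine ⟨q / 2, by omega, ?_⟩
    rw [superY_eq (by omega) hp]; split_ifs <;> omega
  · rw [Nat.odd_iff] at hq'
    refine ⟨(q + (2 * c + 1)) / 2, by omega, ?_⟩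
    rw [superY_eq (by omega) hp]; split_ifs <;> omega

theorem exists_slot_position (hi : i < m) (hi₁ : i₁ < m) :
    ∃ τ < m, ∃ p < m, superX m τ p = i ∧ superY m τ p = i₁ := by
  -- The equations `p + τ ≡ i` and `p + 2τ ≡ i₁` force `τ ≡ i₁ - i` and then `p ≡ i - τ`.
  obtain ⟨τ, hτ, e⟩ : ∃ τ < m, τ + i = i₁ ∨ τ + i = i₁ + m := by
    rcases Nat.lt_or_ge i₁ i with h | h
    · exact ⟨i₁ + m - i, by omega, by omega⟩
    · exact ⟨i₁ - i, by omega, by omega⟩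
  obtain ⟨p, hp, e'⟩ : ∃ p < m, p + τ = i ∨ p + τ = i + m := by
    rcases Nat.lt_or_ge i τ with h | h
    · exact ⟨i + m - τ, by omega, by omega⟩
    · exact ⟨i - τ, by omega, by omega⟩
  refine ⟨τ, hτ, p, hp, ?_, ?_⟩
  · rw [superX_eq hτ hp]; split_ifs <;> omega
  · rw [superY_eq hτ hp]; split_ifs <;> omega

end Labels

/-! ### The games of a time slot -/

theorem mem_slotDay {n m d τ r a b : ℕ} {v : Venue} :
    (⟨a, b, v⟩ : Game ℕ ℕ) ∈ slotDay n m d τ r ↔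
      ∃ p < m, ∃ k k', a = teamLabel m d p (superX m τ p) k ∧
        b = teamLabel m d p (superY m τ p) k' ∧ SuperMeets d (p < n - 3 * m * d) r k k' v := by
  simp only [slotDay, superGameDay, Finset.mem_biUnion, Finset.mem_range]
  refine exists_congr fun p => and_congr_right fun _ => ?_
  split_ifs with h
  · rw [mem_leftDay, eq_true h]
  · rw [mem_normalDay, eq_false h]

section Slots

variable {n m d τ τ₁ r r₁ a b b₁ : ℕ} {v w : Venue}

theorem slotDay_right_unique (hτ : τ < m) (hr : r < 6 * d)
    (h : (⟨a, b, v⟩ : Game ℕ ℕ) ∈ slotDay n m d τ r)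
    (h₁ : (⟨a, b₁, w⟩ : Game ℕ ℕ) ∈ slotDay n m d τ r) : b = b₁ ∧ v = w := by
  obtain ⟨p, hp, k, k', hx, rfl, hs⟩ := mem_slotDay.1 h
  obtain ⟨p₁, hp₁, k₁, k₁', hx₁, rfl, hs₁⟩ := mem_slotDay.1 h₁
  obtain ⟨rfl, rfl⟩ := position_unique_x hτ hp hp₁ hs.lt.1 hs₁.lt.1 (hx.symm.trans hx₁)
  obtain ⟨rfl, rfl⟩ := hs.right_unique hr hs₁
  exact ⟨rfl, rfl⟩

theorem slotDay_left_unique {a₁ : ℕ} (hτ : τ < m) (hr : r < 6 * d)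
    (h : (⟨a, b, v⟩ : Game ℕ ℕ) ∈ slotDay n m d τ r)
    (h₁ : (⟨a₁, b, w⟩ : Game ℕ ℕ) ∈ slotDay n m d τ r) : a = a₁ ∧ v = w := by
  obtain ⟨p, hp, k, k', rfl, hy, hs⟩ := mem_slotDay.1 h
  obtain ⟨p₁, hp₁, k₁, k₁', rfl, hy₁, hs₁⟩ := mem_slotDay.1 h₁
  obtain ⟨rfl, rfl⟩ := position_unique_y hτ hp hp₁ hs.lt.2.1 hs₁.lt.2.1 (hy.symm.trans hy₁)
  obtain ⟨rfl, rfl⟩ := hs.left_unique hr hs₁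
  exact ⟨rfl, rfl⟩

/-- The two members of a team-pair have equal index `3d`, and shift 0 is never played. This supplies
the side condition of `encounter_unique`. -/
theorem SuperMeets.lt_or_lt {L : Prop} {k k' : ℕ} (hr : r < 6 * d) (h : SuperMeets d L r k k' v) :
    k < 3 * d ∨ k' < 3 * d := by
  by_cases hL : L
  · have := h.ne hr hL
    have := h.lt
    omega
  · exact .inl (h.lt.2.2 hL).1

theorem slotDay_no_repeat (hm : Odd m) (hτ : τ < m) (hτ₁ : τ₁ < m) (hr : r < 6 * d)
    (hr₁ : r₁ < 6 * d) (hne : τ = τ₁ → r₁ = r + 1)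
    (h : (⟨a, b, v⟩ : Game ℕ ℕ) ∈ slotDay n m d τ r) :
    (⟨a, b, w⟩ : Game ℕ ℕ) ∉ slotDay n m d τ₁ r₁ := by
  intro h₁
  obtain ⟨p, hp, k, k', hx, hy, h⟩ := mem_slotDay.1 h
  obtain ⟨p₁, hp₁, k₁, k₁', hx₁, hy₁, h₁⟩ := mem_slotDay.1 h₁
  obtain ⟨rfl, rfl, rfl, rfl⟩ := encounter_unique hm hτ hτ₁ hp hp₁ h.lt.1 h.lt.2.1 h₁.lt.1
    h₁.lt.2.1 (h.lt_or_lt hr) (hx.symm.trans hx₁) (hy.symm.trans hy₁)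
  obtain rfl := hne rfl
  exact h.not_succ hr₁ h₁

/-- The case condition mentions only the slot and the team, not the game, so that it can serve as
the predicate of a `VenuePattern`; the position it refers to is unique by `position_unique_x`. -/
theorem slotDay_venue_x (hτ : τ < m) (h : (⟨a, b, v⟩ : Game ℕ ℕ) ∈ slotDay n m d τ r) :
    ((∃ p < m, p < n - 3 * m * d ∧ ∃ k < 3 * d + 1, a = teamLabel m d p (superX m τ p) k) →
      (v = .Y ↔ r % 2 = 0)) ∧
    ((¬ ∃ p < m, p < n - 3 * m * d ∧ ∃ k < 3 * d + 1, a = teamLabel m d p (superX m τ p) k) →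
      (v = .Y ↔ (r + (6 - a % 3)) % 6 < 3)) := by
  obtain ⟨p, hp, k, k', hx, hy, h⟩ := mem_slotDay.1 h
  constructor
  · rintro ⟨p₁, hp₁, hl, k₁, hk₁, hx₁⟩
    obtain ⟨rfl, rfl⟩ := position_unique_x hτ hp hp₁ h.lt.1 hk₁ (hx.symm.trans hx₁)
    exact h.venue.1 hl
  · intro hn
    have hL : ¬ p < n - 3 * m * d := fun hl => hn ⟨p, hp, hl, k, h.lt.1, hx⟩
    rw [hx, teamLabel_mod_three (h.lt.2.2 hL).1]
    exact h.venue.2.1 hL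

theorem slotDay_venue_y (hτ : τ < m) (h : (⟨a, b, v⟩ : Game ℕ ℕ) ∈ slotDay n m d τ r) :
    ((∃ p < m, p < n - 3 * m * d ∧ ∃ k < 3 * d + 1, b = teamLabel m d p (superY m τ p) k) →
      (v = .Y ↔ r % 2 = 0)) ∧
    ((¬ ∃ p < m, p < n - 3 * m * d ∧ ∃ k < 3 * d + 1, b = teamLabel m d p (superY m τ p) k) →
      (v = .Y ↔ (r + (6 - b % 3)) % 6 < 3)) := by
  obtain ⟨p, hp, k, k', hx, hy, h⟩ := mem_slotDay.1 h
  constructor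
  · rintro ⟨p₁, hp₁, hl, k₁, hk₁, hy₁⟩
    obtain ⟨rfl, rfl⟩ := position_unique_y hτ hp hp₁ h.lt.2.1 hk₁ (hy.symm.trans hy₁)
    exact h.venue.1 hl
  · intro hn
    have hL : ¬ p < n - 3 * m * d := fun hl => hn ⟨p, hp, hl, k', h.lt.2.1, hy⟩
    rw [hy, teamLabel_mod_three (h.lt.2.2 hL).2]
    exact h.venue.2.2 hL

end Slots

/-! ### The games of the last time slot -/

/-- `a` and `b` meet in the games `A_i` of the last time slot. -/
def LastMeets (n m d i a b : ℕ) : Prop :=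
  (∃ k k', k < n - 3 * m * d ∧ k' = (k + i) % (n - 3 * m * d) ∧
    a = 3 * m * d + k ∧ b = 3 * m * d + k') ∨
  ∃ τ < m, ∃ k < 3 * d, a = teamLabel m d i (superX m τ i) k ∧ b = teamLabel m d i (superY m τ i) k

theorem mem_pairGames_union_leftOverGames {n m d i : ℕ} (a b : ℕ) (v : Venue) :
    (⟨a, b, v⟩ : Game ℕ ℕ) ∈ pairGames n m d i ∪ leftOverGames m d i ↔
      LastMeets n m d i a b ∧ v = .Y := by
  simp only [pairGames, leftOverGames, Finset.mem_union, mem_shiftMatching, Finset.mem_biUnion,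
    Finset.mem_image, Finset.mem_range, away, Game.mk.injEq, LastMeets]
  rw [or_and_right]
  refine or_congr Iff.rfl ?_
  constructor
  · rintro ⟨τ, hτ, k, hk, rfl, rfl, rfl⟩
    exact ⟨⟨τ, hτ, k, hk, rfl, rfl⟩, rfl⟩
  · rintro ⟨⟨τ, hτ, k, hk, rfl, rfl⟩, rfl⟩
    exact ⟨τ, hτ, k, hk, rfl, rfl, rfl⟩

theorem mem_lastSlotDay {n m d r a b : ℕ} {v : Venue} :
    (⟨a, b, v⟩ : Game ℕ ℕ) ∈ lastSlotDay n m d r ↔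
      if r < n - 3 * m * d then LastMeets n m d r a b ∧ (v = .Y ↔ r % 2 = 0)
      else LastMeets n m d (r - (n - 3 * m * d)) a b ∧
        (v = .Y ↔ (r - (n - 3 * m * d)) % 2 = 1) := by
  simp only [lastSlotDay]
  split_ifs with h
  · rw [mem_alt mem_pairGames_union_leftOverGames, Nat.even_iff]
  · rw [mem_bar_alt mem_pairGames_union_leftOverGames, Nat.not_even_iff]

section LastSlot

variable {n m d i i₁ a a₁ b b₁ r τ : ℕ} {v w : Venue}

theorem LastMeets.right_unique (hi : i < m)
    (h : LastMeets n m d i a b) (h₁ : LastMeets n m d i a b₁) : b = b₁ := by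
  rcases h with ⟨k, k', hk, hk', ha, hb⟩ | ⟨τ, hτ, k, hk, ha, hb⟩ <;>
    rcases h₁ with ⟨k₁, k₁', hk₁, hk₁', ha₁, hb₁⟩ | ⟨τ₁, hτ₁, k₁, hk₁, ha₁, hb₁⟩
  · obtain rfl : k = k₁ := by omega
    rw [hb, hb₁, hk', hk₁']
  · rw [teamLabel_of_lt hk₁] at ha₁
    have := super_label_lt (superX_lt (p := i) (τ := τ₁) (by omega : 0 < m)) hk₁
    omega
  · rw [teamLabel_of_lt hk] at ha
    have := super_label_lt (superX_lt (p := i) (τ := τ) (by omega : 0 < m)) hk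
    omega
  · obtain ⟨rfl, e, -⟩ := teamLabel_inj (superX_lt (by omega)) (superX_lt (by omega))
      (by omega) (by omega) (ha.symm.trans ha₁)
    obtain rfl := slot_unique_x hτ hτ₁ hi (e hk)
    rw [hb, hb₁]

theorem LastMeets.left_unique (hm : Odd m) (hi : i < m) (hl : i < n - 3 * m * d)
    (h : LastMeets n m d i a b) (h₁ : LastMeets n m d i a₁ b) : a = a₁ := by
  rcases h with ⟨k, k', hk, hk', ha, hb⟩ | ⟨τ, hτ, k, hk, ha, hb⟩ <;>
    rcases h₁ with ⟨k₁, k₁', hk₁, hk₁', ha₁, hb₁⟩ | ⟨τ₁, hτ₁, k₁, hk₁, ha₁, hb₁⟩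
  · obtain rfl : k' = k₁' := by omega
    generalize n - 3 * m * d = l at *
    rw [mod_eq_of_lt_three_mul (by omega)] at hk' hk₁'
    split_ifs at hk' hk₁' <;> omega
  · rw [teamLabel_of_lt hk₁] at hb₁
    have := super_label_lt (superY_lt (p := i) (τ := τ₁) (by omega : 0 < m)) hk₁
    omega
  · rw [teamLabel_of_lt hk] at hb
    have := super_label_lt (superY_lt (p := i) (τ := τ) (by omega : 0 < m)) hk
    omega
  · obtain ⟨rfl, e, -⟩ := teamLabel_inj (superY_lt (by omega)) (superY_lt (by omega))
      (by omega) (by omega) (hb.symm.trans hb₁)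
    obtain rfl := slot_unique_y hm hτ hτ₁ hi (e hk)
    rw [ha, ha₁]

theorem LastMeets.index_unique (hm : Odd m) (hi : i < m) (hi₁ : i₁ < m) (hl : i < n - 3 * m * d)
    (hl₁ : i₁ < n - 3 * m * d)
    (h : LastMeets n m d i a b) (h₁ : LastMeets n m d i₁ a b) : i = i₁ := by
  rcases h with ⟨k, k', hk, hk', ha, hb⟩ | ⟨τ, hτ, k, hk, ha, hb⟩ <;>
    rcases h₁ with ⟨k₁, k₁', hk₁, hk₁', ha₁, hb₁⟩ | ⟨τ₁, hτ₁, k₁, hk₁, ha₁, hb₁⟩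
  · obtain rfl : k = k₁ := by omega
    obtain rfl : k' = k₁' := by omega
    generalize n - 3 * m * d = l at *
    rw [mod_eq_of_lt_three_mul (by omega)] at hk' hk₁'
    split_ifs at hk' hk₁' <;> omega
  · rw [teamLabel_of_lt hk₁] at hb₁
    have := super_label_lt (superY_lt (p := i₁) (τ := τ₁) (by omega : 0 < m)) hk₁
    omega
  · rw [teamLabel_of_lt hk] at hb
    have := super_label_lt (superY_lt (p := i) (τ := τ) (by omega : 0 < m)) hk
    omega
  · exact (encounter_unique hm hτ hτ₁ hi hi₁ (by omega) (by omega) (by omega) (by omega) (.inl hk)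
      (ha.symm.trans ha₁) (hb.symm.trans hb₁)).2.1

/-- A pair in `A_i` either consists of two team-pair members, who never meet earlier, or has equal
indices in the left super-game that is its only encounter. -/
theorem LastMeets.not_mem_slotDay (hm : Odd m) (hi : i < m) (hl : i < n - 3 * m * d) (hτ : τ < m)
    (hr : r < 6 * d) (h : LastMeets n m d i a b) :
    (⟨a, b, v⟩ : Game ℕ ℕ) ∉ slotDay n m d τ r := by
  intro h₁
  obtain ⟨p, hp, k, k', ha, hb, h₁⟩ := mem_slotDay.1 h₁
  have hkk := h₁.lt_or_lt hr
  rcases h with ⟨k₁, k₁', -, -, ha₁, hb₁⟩ | ⟨τ₁, hτ₁, k₁, hk₁, ha₁, hb₁⟩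
  · rcases hkk with h | h
    · rw [teamLabel_of_lt h] at ha
      have := super_label_lt (superX_lt (p := p) (τ := τ) (by omega : 0 < m)) h
      omega
    · rw [teamLabel_of_lt h] at hb
      have := super_label_lt (superY_lt (p := p) (τ := τ) (by omega : 0 < m)) h
      omega
  · obtain ⟨rfl, rfl, rfl, h⟩ := encounter_unique hm hτ hτ₁ hp hi h₁.lt.1 h₁.lt.2.1 (by omega)
      (by omega) hkk (ha.symm.trans ha₁) (hb.symm.trans hb₁)
    exact h₁.ne hr hl h.symm

end LastSlot

/-! ### The days of the construction -/

section Construction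

variable {n m d : ℕ}

theorem slot_bounds {t : ℕ} (hd : 0 < d) (ht : t < 6 * m * d) :
    t / (6 * d) < m ∧ t % (6 * d) < 6 * d :=
  ⟨Nat.div_lt_of_lt_mul (by rwa [show 6 * d * m = 6 * m * d by ring]), Nat.mod_lt _ (by omega)⟩

theorem constructionDay_of_lt {t : ℕ} (ht : t < 6 * m * d) :
    constructionDay n m d t = slotDay n m d (t / (6 * d)) (t % (6 * d)) := if_pos ht

theorem constructionDay_of_le {t : ℕ} (ht : 6 * m * d ≤ t) :
    constructionDay n m d t = lastSlotDay n m d (t - 6 * m * d) := if_neg (by omega)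

theorem two_mul_eq (h : 3 * m * d ≤ n) : 2 * n = 6 * m * d + 2 * (n - 3 * m * d) := by
  have : 6 * m * d = 2 * (3 * m * d) := by ring
  omega

theorem exists_day_of_slotDay {τ r a b : ℕ} {v : Venue} (h : Admissible n m d) (hτ : τ < m)
    (hr : r < 6 * d) (hg : (⟨a, b, v⟩ : Game ℕ ℕ) ∈ slotDay n m d τ r) :
    ∃ t < 2 * n, (⟨a, b, v⟩ : Game ℕ ℕ) ∈ constructionDay n m d t := by
  have h1 : 6 * d * (τ + 1) ≤ 6 * d * m := Nat.mul_le_mul_left _ hτ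
  have h2 : 6 * d * m = 6 * m * d := by ring
  rw [mul_add, h2] at h1
  have h3 := two_mul_eq h.2.2.1
  refine ⟨6 * d * τ + r, by omega, ?_⟩
  rw [constructionDay_of_lt (by omega), Nat.mul_add_mod, Nat.mod_eq_of_lt hr,
    Nat.mul_add_div (by omega), Nat.div_eq_of_lt hr, add_zero]
  exact hg

theorem exists_day_of_lastMeets {i a b : ℕ} (h : Admissible n m d)
    (hi : i < n - 3 * m * d) (hg : LastMeets n m d i a b) (v : Venue) :
    ∃ t < 2 * n, (⟨a, b, v⟩ : Game ℕ ℕ) ∈ constructionDay n m d t := by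
  have h3 := two_mul_eq h.2.2.1
  -- `A_i` is played on days `i` and `l + i` of the last slot, at opposite venues.
  by_cases hv : v = .Y ↔ i % 2 = 0
  · refine ⟨6 * m * d + i, by omega, ?_⟩
    rw [constructionDay_of_le (by omega), mem_lastSlotDay, Nat.add_sub_cancel_left, if_pos hi]
    exact ⟨hg, hv⟩
  · refine ⟨6 * m * d + (n - 3 * m * d + i), by omega, ?_⟩
    rw [constructionDay_of_le (by omega), mem_lastSlotDay, Nat.add_sub_cancel_left,
      if_neg (by omega), Nat.add_sub_cancel_left]
    refine ⟨hg, ?_⟩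
    rcases Nat.mod_two_eq_zero_or_one i with h | h <;> simp_all

theorem exists_day (h : Admissible n m d) {a b : ℕ} (ha : a < n) (hb : b < n) (v : Venue) :
    ∃ t < 2 * n, (⟨a, b, v⟩ : Game ℕ ℕ) ∈ constructionDay n m d t := by
  have ⟨hd, hm, hle, hl⟩ := h
  rcases exists_label hle ha with ⟨i, hi, k, hk, rfl'⟩ | ⟨p, hp, rfl⟩ <;>
    rcases exists_label hle hb with ⟨i', hi', k', hk', rfl''⟩ | ⟨p', hp', rfl⟩
  · obtain ⟨τ, hτ, p, hp, rfl, rfl⟩ := exists_slot_position hi hi'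
    by_cases hL : p < n - 3 * m * d
    · by_cases hkk : k = k'
      · subst hkk
        exact exists_day_of_lastMeets h hL (.inr ⟨τ, hτ, k, hk, rfl' _, rfl'' _⟩) v
      · obtain ⟨r, hr, hs⟩ := SuperMeets.exists_day_of_left (L := p < n - 3 * m * d) hL
          hk.le hk'.le hkk v
        exact exists_day_of_slotDay h hτ hr (mem_slotDay.2 ⟨p, hp, k, k', rfl' _, rfl'' _, hs⟩)
    · obtain ⟨r, hr, hs⟩ := SuperMeets.exists_day_of_not_left hL hk hk' v
      exact exists_day_of_slotDay h hτ hr (mem_slotDay.2 ⟨p, hp, k, k', rfl' _, rfl'' _, hs⟩)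
  · obtain ⟨τ, hτ, rfl⟩ := exists_slot_x (by omega : p' < m) hi
    obtain ⟨r, hr, hs⟩ := SuperMeets.exists_day_of_left (L := p' < n - 3 * m * d) hp'
      hk.le le_rfl hk.ne v
    exact exists_day_of_slotDay h hτ hr
      (mem_slotDay.2 ⟨p', by omega, k, _, rfl' _, (teamLabel_of_le le_rfl).symm, hs⟩)
  · obtain ⟨τ, hτ, rfl⟩ := exists_slot_y hm (by omega : p < m) hi'
    obtain ⟨r, hr, hs⟩ := SuperMeets.exists_day_of_left (L := p < n - 3 * m * d) hp
      le_rfl hk'.le hk'.ne' v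
    exact exists_day_of_slotDay h hτ hr
      (mem_slotDay.2 ⟨p, by omega, _, k', (teamLabel_of_le le_rfl).symm, rfl'' _, hs⟩)
  · obtain ⟨i, hi, e⟩ : ∃ i < n - 3 * m * d, p' = (p + i) % (n - 3 * m * d) := by
      rcases Nat.lt_or_ge p' p with h | h
      · exact ⟨p' + (n - 3 * m * d) - p, by omega, by
          rw [mod_eq_of_lt_three_mul (by omega)]; split_ifs <;> omega⟩
      · exact ⟨p' - p, by omega, by
          rw [mod_eq_of_lt_three_mul (by omega)]; split_ifs <;> omega⟩
    exact exists_day_of_lastMeets h hi (.inl ⟨p, p', hp, e, rfl, rfl⟩) v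

theorem constructionDay_right_unique (h : Admissible n m d) {t a b b₁ : ℕ} {v w : Venue}
    (ht : t < 2 * n) (hg : (⟨a, b, v⟩ : Game ℕ ℕ) ∈ constructionDay n m d t)
    (hg₁ : (⟨a, b₁, w⟩ : Game ℕ ℕ) ∈ constructionDay n m d t) : b = b₁ ∧ v = w := by
  have ⟨hd, hm, hle, hl⟩ := h
  have h2 := two_mul_eq hle
  rcases Nat.lt_or_ge t (6 * m * d) with h' | h'
  · rw [constructionDay_of_lt h'] at hg hg₁
    exact slotDay_right_unique (slot_bounds hd h').1 (slot_bounds hd h').2 hg hg₁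
  · rw [constructionDay_of_le h', mem_lastSlotDay] at hg hg₁
    split_ifs at hg hg₁
    · exact ⟨hg.1.right_unique (by omega) hg₁.1, Venue.eq_of_iff hg.2 hg₁.2⟩
    · exact ⟨hg.1.right_unique (by omega) hg₁.1, Venue.eq_of_iff hg.2 hg₁.2⟩

theorem constructionDay_left_unique (h : Admissible n m d) {t a a₁ b : ℕ} {v w : Venue}
    (ht : t < 2 * n) (hg : (⟨a, b, v⟩ : Game ℕ ℕ) ∈ constructionDay n m d t)
    (hg₁ : (⟨a₁, b, w⟩ : Game ℕ ℕ) ∈ constructionDay n m d t) : a = a₁ ∧ v = w := by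
  have ⟨hd, hm, hle, hl⟩ := h
  have h2 := two_mul_eq hle
  rcases Nat.lt_or_ge t (6 * m * d) with h' | h'
  · rw [constructionDay_of_lt h'] at hg hg₁
    exact slotDay_left_unique (slot_bounds hd h').1 (slot_bounds hd h').2 hg hg₁
  · rw [constructionDay_of_le h', mem_lastSlotDay] at hg hg₁
    split_ifs at hg hg₁
    · exact ⟨hg.1.left_unique hm (by omega) (by omega) hg₁.1, Venue.eq_of_iff hg.2 hg₁.2⟩
    · exact ⟨hg.1.left_unique hm (by omega) (by omega) hg₁.1, Venue.eq_of_iff hg.2 hg₁.2⟩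

/-- A pair that meets in the last time slot does not meet in another one. -/
theorem constructionDay_last_disjoint (h : Admissible n m d) {t t₁ a b : ℕ} {v w : Venue}
    (ht : t < 6 * m * d) (ht₁ : 6 * m * d ≤ t₁) (ht₁' : t₁ < 2 * n)
    (hg : (⟨a, b, v⟩ : Game ℕ ℕ) ∈ constructionDay n m d t) :
    (⟨a, b, w⟩ : Game ℕ ℕ) ∉ constructionDay n m d t₁ := by
  intro hg₁
  have ⟨hd, hm, hle, hl⟩ := h
  have h2 := two_mul_eq hle
  rw [constructionDay_of_lt ht] at hg
  rw [constructionDay_of_le ht₁, mem_lastSlotDay] at hg₁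
  obtain ⟨hτ, hr⟩ := slot_bounds hd ht
  split_ifs at hg₁
  · exact hg₁.1.not_mem_slotDay hm (by omega) (by omega) hτ hr hg
  · exact hg₁.1.not_mem_slotDay hm (by omega) (by omega) hτ hr hg

theorem constructionDay_no_repeat (h : Admissible n m d) {t a b : ℕ} {v w : Venue}
    (ht : t + 1 < 2 * n) (hlast : n - 3 * m * d = 1 → t + 2 < 2 * n)
    (hg : (⟨a, b, v⟩ : Game ℕ ℕ) ∈ constructionDay n m d t) :
    (⟨a, b, w⟩ : Game ℕ ℕ) ∉ constructionDay n m d (t + 1) := by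
  have ⟨hd, hm, hle, hl⟩ := h
  have h2 := two_mul_eq hle
  rcases Nat.lt_or_ge t (6 * m * d) with h' | h'
  · rcases Nat.lt_or_ge (t + 1) (6 * m * d) with h'' | h''
    · rw [constructionDay_of_lt h'] at hg
      rw [constructionDay_of_lt h'']
      obtain ⟨hτ, hr⟩ := slot_bounds hd h'
      obtain ⟨hτ₁, hr₁⟩ := slot_bounds hd h''
      refine slotDay_no_repeat hm hτ hτ₁ hr hr₁ (fun e => ?_) hg
      have e1 := Nat.div_add_mod t (6 * d)
      have e2 := Nat.div_add_mod (t + 1) (6 * d)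
      rw [← e] at e2
      omega
    · exact constructionDay_last_disjoint h h' h'' ht hg
  · intro hg₁
    rw [constructionDay_of_le h', mem_lastSlotDay] at hg
    rw [constructionDay_of_le (by omega), mem_lastSlotDay] at hg₁
    -- Consecutive days of the last slot carry different indices unless `l = 1`, where both are 0;
    -- `hlast` excludes that case.
    split_ifs at hg hg₁ <;>
    · have := hg.1.index_unique hm (by omega) (by omega) (by omega) (by omega) hg₁.1
      omega

/-! ### Venue patterns and the bounded-by-3 constraint -/

/-- The days `t` on which the game of a team is at the venue `Y`, if the team takes part in a left
super-game on the days `t` in the slots with `Q (t / 6)`, and `c` is its label modulo 3. -/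
def VenuePattern (n m d c : ℕ) (Q : ℕ → Prop) (t : ℕ) : Prop :=
  (t < 6 * m * d ∧ Q (t / 6) ∧ t % 2 = 0) ∨
  (t < 6 * m * d ∧ ¬ Q (t / 6) ∧ (t + (6 - c)) % 6 < 3) ∨
  (6 * m * d ≤ t ∧ t < 6 * m * d + (n - 3 * m * d) ∧ t % 2 = 0) ∨
  (6 * m * d + (n - 3 * m * d) ≤ t ∧ (t - (n - 3 * m * d)) % 2 = 1)

theorem lastSlotDay_venue {t a b : ℕ} {v : Venue} (ht : 6 * m * d ≤ t) (c : ℕ) (Q : ℕ → Prop)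
    (hg : (⟨a, b, v⟩ : Game ℕ ℕ) ∈ lastSlotDay n m d (t - 6 * m * d)) :
    v = .Y ↔ VenuePattern n m d c Q t := by
  have h6 : 6 * m * d = 2 * (3 * m * d) := by ring
  rw [mem_lastSlotDay] at hg
  unfold VenuePattern
  split_ifs at hg <;> rw [hg.2] <;> omega

/-- Slots have length `6d`, a multiple of 6, so the day within a slot may be replaced by `t` modulo
2 or 6, and the slot number is `t / 6 / d`. -/
theorem slotDay_venue_pattern {t c : ℕ} {v : Venue} {P : ℕ → Prop} (ht : t < 6 * m * d)
    (hP : P (t / (6 * d)) → (v = .Y ↔ t % (6 * d) % 2 = 0))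
    (hP' : ¬ P (t / (6 * d)) → (v = .Y ↔ (t % (6 * d) + (6 - c)) % 6 < 3)) :
    v = .Y ↔ VenuePattern n m d c (fun u => P (u / d)) t := by
  have e1 : t % (6 * d) % 2 = t % 2 := Nat.mod_mod_of_dvd _ ⟨3 * d, by ring⟩
  have e2 : t % (6 * d) % 6 = t % 6 := Nat.mod_mod_of_dvd _ ⟨d, rfl⟩
  rw [← Nat.div_div_eq_div_mul] at hP hP'
  have h1 : ¬ 6 * m * d ≤ t := by omega
  have h2 : ¬ 6 * m * d + (n - 3 * m * d) ≤ t := by omega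
  unfold VenuePattern
  by_cases h : P (t / 6 / d)
  · rw [hP h, e1]
    simp only [h, ht, h1, h2, true_and, not_true_eq_false, false_and, or_false]
  · rw [hP' h]
    simp only [h, ht, h1, h2, true_and, not_false_eq_true, false_and, or_false, false_or]
    omega

theorem exists_venuePattern_x (h : Admissible n m d) (a : ℕ) :
    ∃ Q : ℕ → Prop, ∀ t b v, (⟨a, b, v⟩ : Game ℕ ℕ) ∈ constructionDay n m d t →
      (v = .Y ↔ VenuePattern n m d (a % 3) Q t) := by
  set P : ℕ → Prop := fun τ => ∃ p < m, p < n - 3 * m * d ∧ ∃ k < 3 * d + 1,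
    a = teamLabel m d p (superX m τ p) k
  refine ⟨fun u => P (u / d), fun t b v hg => ?_⟩
  rcases Nat.lt_or_ge t (6 * m * d) with h' | h'
  · rw [constructionDay_of_lt h'] at hg
    have := slotDay_venue_x (slot_bounds h.1 h').1 hg
    exact slotDay_venue_pattern (P := P) h' this.1 this.2
  · rw [constructionDay_of_le h'] at hg
    exact lastSlotDay_venue h' _ _ hg

theorem exists_venuePattern_y (h : Admissible n m d) (b : ℕ) :
    ∃ Q : ℕ → Prop, ∀ t a v, (⟨a, b, v⟩ : Game ℕ ℕ) ∈ constructionDay n m d t →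
      (v = .Y ↔ VenuePattern n m d (b % 3) Q t) := by
  set P : ℕ → Prop := fun τ => ∃ p < m, p < n - 3 * m * d ∧ ∃ k < 3 * d + 1,
    b = teamLabel m d p (superY m τ p) k
  refine ⟨fun u => P (u / d), fun t a v hg => ?_⟩
  rcases Nat.lt_or_ge t (6 * m * d) with h' | h'
  · rw [constructionDay_of_lt h'] at hg
    have := slotDay_venue_y (slot_bounds h.1 h').1 hg
    exact slotDay_venue_pattern (P := P) h' this.1 this.2
  · rw [constructionDay_of_le h'] at hg
    exact lastSlotDay_venue h' _ _ hg

theorem venuePattern_of_lt {c : ℕ} {Q : ℕ → Prop} {t : ℕ} (ht : t < 6 * m * d) :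
    (Q (t / 6) → (VenuePattern n m d c Q t ↔ t % 2 = 0)) ∧
      (¬ Q (t / 6) → (VenuePattern n m d c Q t ↔ (t + (6 - c)) % 6 < 3)) := by
  have h1 : ¬ 6 * m * d ≤ t := by omega
  have h2 : ¬ 6 * m * d + (n - 3 * m * d) ≤ t := by omega
  constructor <;> intro h <;> simp [VenuePattern, h, ht, h1, h2]

theorem venuePattern_of_le {c : ℕ} {Q : ℕ → Prop} {t : ℕ} (ht : 6 * m * d ≤ t) :
    VenuePattern n m d c Q t ↔ (t < 6 * m * d + (n - 3 * m * d) ∧ t % 2 = 0) ∨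
      (6 * m * d + (n - 3 * m * d) ≤ t ∧ (t - (n - 3 * m * d)) % 2 = 1) := by
  have h1 : ¬ t < 6 * m * d := by omega
  simp [VenuePattern, ht, h1]

/-- Four days touch at most two blocks, so a finite check suffices. The tight case is an alternating
block, ending at `X`, followed by a delay `c = 2`, starting `XXY`. -/
theorem not_four_of_two_blocks : ∀ s < 6, ∀ c < 3, ∀ q q' v : Bool,
    ¬ ∀ i < 4, v = if (if s + i < 6 then q else q') then decide ((s + i) % 2 = 0)
      else decide ((s + i + (6 - c)) % 6 < 3) := by
  decide

/-- In a sequence of blocks of six days, each of which either alternates or follows one fixed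
periodic pattern of three and three days, no four consecutive days agree. -/
theorem not_four_of_blocks {c t : ℕ} {Q W : ℕ → Prop} {v : Prop} (hc : c < 3)
    (hW : ∀ i < 4, (Q ((t + i) / 6) → (W i ↔ (t + i) % 2 = 0)) ∧
      (¬ Q ((t + i) / 6) → (W i ↔ (t + i + (6 - c)) % 6 < 3))) :
    ¬ ∀ i < 4, (v ↔ W i) := by
  classical
  intro h
  refine not_four_of_two_blocks (t % 6) (Nat.mod_lt _ (by omega)) c hc (decide (Q (t / 6)))
    (decide (Q (t / 6 + 1))) (decide v) fun i hi => ?_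
  have e : (if t % 6 + i < 6 then decide (Q (t / 6)) else decide (Q (t / 6 + 1))) =
      decide (Q ((t + i) / 6)) := by
    split_ifs with h'
    · rw [show (t + i) / 6 = t / 6 by omega]
    · rw [show (t + i) / 6 = t / 6 + 1 by omega]
  rw [e]
  by_cases q : Q ((t + i) / 6)
  · rw [if_pos (decide_eq_true q), decide_eq_decide, h i hi, (hW i hi).1 q]
    omega
  · rw [if_neg (by simpa using q), decide_eq_decide, h i hi, (hW i hi).2 q]
    omega

theorem VenuePattern.not_four {c : ℕ} {Q : ℕ → Prop} (hc : c < 3) (v : Prop) {t : ℕ}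
    (hle : 3 * m * d ≤ n) (ht : t + 3 < 2 * n) :
    ¬ ∀ i < 4, (v ↔ VenuePattern n m d c Q (t + i)) := by
  intro h
  have h6 : 6 * m * d = 6 * (m * d) := by ring
  rcases Nat.lt_or_ge (t + 3) (6 * m * d) with h' | h'
  · exact not_four_of_blocks hc (fun i hi => venuePattern_of_lt (by omega)) h
  · have h3 := two_mul_eq hle
    have late (i : ℕ) (hi : i < 4) (hti : 6 * m * d ≤ t + i) := (h i hi).trans (venuePattern_of_le hti)
    -- The days of the window before the last slot all lie in the final six-day block, number `md -
    -- 1`.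
    have early (i : ℕ) (hi : i < 4) (hti : t + i < 6 * m * d) :
        (Q (m * d - 1) → (v ↔ (t + i) % 2 = 0)) ∧
          (¬ Q (m * d - 1) → (v ↔ (t + i + (6 - c)) % 6 < 3)) := by
      have := venuePattern_of_lt (n := n) (c := c) (Q := Q) hti
      rwa [← h i hi, show (t + i) / 6 = m * d - 1 by omega] at this
    clear h
    rw [h6] at h' h3 late early
    generalize m * d = M at *
    generalize n - 3 * m * d = l at *
    have late0 := late 0 (by omega)
    have late1 := late 1 (by omega)
    have late2 := late 2 (by omega)
    have late3 := late 3 (by omega) h'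
    have early0 := early 0 (by omega)
    have early1 := early 1 (by omega)
    have early2 := early 2 (by omega)
    clear late early
    -- Split by how many days precede the last slot. That slot starts at `Y`, after a block ending
    -- at `X`, and alternates except for two adjacent `X` in its middle when `l` is even.
    obtain ht | ht | ht | ht : 6 * M ≤ t ∨ t + 1 = 6 * M ∨ t + 2 = 6 * M ∨ t + 3 = 6 * M := by omega
    · replace late0 := late0 (by omega)
      replace late1 := late1 (by omega)
      replace late2 := late2 (by omega)
      clear early0 early1 early2
      by_cases hv : v <;> simp only [hv, true_iff, false_iff] at late0 late1 late2 late3 <;> omega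
    · replace late1 := late1 (by omega)
      replace late2 := late2 (by omega)
      replace early0 := early0 (by omega)
      clear late0 early1 early2
      by_cases q : Q (M - 1) <;>
        simp only [q, true_imp_iff, not_true_eq_false, not_false_eq_true, false_imp_iff, and_true,
          true_and] at early0 <;>
      by_cases hv : v <;> simp only [hv, true_iff, false_iff] at late1 late2 late3 early0 <;> omega
    · replace late2 := late2 (by omega)
      replace early0 := early0 (by omega)
      replace early1 := early1 (by omega)
      clear late0 late1 early2
      by_cases q : Q (M - 1) <;>
        simp only [q, true_imp_iff, not_true_eq_false, not_false_eq_true, false_imp_iff, and_true,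
          true_and] at early0 early1 <;>
      by_cases hv : v <;> simp only [hv, true_iff, false_iff] at late2 late3 early0 early1 <;> omega
    · replace early0 := early0 (by omega)
      replace early1 := early1 (by omega)
      replace early2 := early2 (by omega)
      clear late0 late1 late2
      by_cases q : Q (M - 1) <;>
        simp only [q, true_imp_iff, not_true_eq_false, not_false_eq_true, false_imp_iff, and_true,
          true_and] at early0 early1 early2 <;>
      by_cases hv : v <;> simp only [hv, true_iff, false_iff] at late3 early0 early1 early2 <;> omega

/-- If there is one team-pair, then the last day and the first three days do not agree. -/
theorem VenuePattern.not_four_rotated {c : ℕ} {Q : ℕ → Prop} (hc : c < 3) (v : Prop)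
    (hl : n - 3 * m * d = 1) (hmd : 0 < m * d) :
    ¬ ((v ↔ VenuePattern n m d c Q (2 * n - 1)) ∧
      ∀ i < 3, (v ↔ VenuePattern n m d c Q i)) := by
  rintro ⟨h, h'⟩
  have h6 : 6 * m * d = 6 * (m * d) := by ring
  have h3 : 3 * m * d = 3 * (m * d) := by ring
  have h0 := h' 0 (by omega)
  have h1 := h' 1 (by omega)
  have h2 := h' 2 (by omega)
  have p0 := venuePattern_of_lt (n := n) (m := m) (d := d) (c := c) (Q := Q) (t := 0) (by omega)
  have p1 := venuePattern_of_lt (n := n) (m := m) (d := d) (c := c) (Q := Q) (t := 1) (by omega)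
  have p2 := venuePattern_of_lt (n := n) (m := m) (d := d) (c := c) (Q := Q) (t := 2) (by omega)
  rw [← h0] at p0
  rw [← h1] at p1
  rw [← h2] at p2
  -- The rotated day is at `X`, whereas day 2 of either kind of block is at `Y`.
  rw [venuePattern_of_le (by omega), hl] at h
  simp only [Nat.reduceDiv] at p0 p1 p2
  clear h' h0 h1 h2
  by_cases q : Q 0 <;>
    simp only [q, true_imp_iff, not_true_eq_false, not_false_eq_true, false_imp_iff, and_true,
      true_and] at p0 p1 p2 <;>
  by_cases hv : v <;> simp only [hv, true_iff, false_iff, not_true_eq_false] at h p0 p1 p2 <;> omega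

end Construction

/-! ### Feasibility -/

/-- A choice function for `hex` is injective by `hun`, hence bijective by cardinality. Any `d`
related to `g` is then the chosen value of some `g'`, and `hun` gives `g' = g`. -/
theorem existsUnique_of_card_eq {G D : Type*} [Finite G] [Finite D] (hc : Nat.card G = Nat.card D)
    {R : G → D → Prop} (hex : ∀ g, ∃ d, R g d) (hun : ∀ d g g', R g d → R g' d → g = g') :
    (∀ d, ∃! g, R g d) ∧ ∀ g, ∃! d, R g d := by
  choose f hf using hex
  have hi : Function.Injective f := fun g g' h => hun _ _ _ (hf g) (h ▸ hf g')
  have hb := hi.bijective_of_nat_card_le hc.ge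
  constructor
  · intro d
    obtain ⟨g, rfl⟩ := hb.2 d
    exact ⟨g, hf g, fun g' h => hun _ _ _ h (hf g)⟩
  · refine fun g => ⟨f g, hf g, fun d h => ?_⟩
    obtain ⟨g', rfl⟩ := hb.2 d
    rw [hun _ _ _ h (hf g')]

/-- Games are triples. -/
def gameEquiv (X Y : Type*) : Game X Y ≃ (X × Y) × Bool where
  toFun g := ((g.x, g.y), match g.venue with | .X => true | .Y => false)
  invFun p := ⟨p.1.1, p.1.2, if p.2 then .X else .Y⟩
  left_inv g := by obtain ⟨x, y, v⟩ := g; cases v <;> rfl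
  right_inv p := by obtain ⟨⟨x, y⟩, v⟩ := p; cases v <;> rfl

theorem isFeasible_of_days {n : ℕ} {X Y : Type*} (labX : X ≃ Fin n) (labY : Y ≃ Fin n)
    (D : ℕ → Games)
    (hex : ∀ a < n, ∀ b < n, ∀ v, ∃ t < 2 * n, (⟨a, b, v⟩ : Game ℕ ℕ) ∈ D t)
    (hx : ∀ t < 2 * n, ∀ a b b' v w, (⟨a, b, v⟩ : Game ℕ ℕ) ∈ D t →
      (⟨a, b', w⟩ : Game ℕ ℕ) ∈ D t → b = b' ∧ v = w)
    (hy : ∀ t < 2 * n, ∀ a a' b v w, (⟨a, b, v⟩ : Game ℕ ℕ) ∈ D t →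
      (⟨a', b, w⟩ : Game ℕ ℕ) ∈ D t → a = a' ∧ v = w)
    (hnr : ∀ t, t + 1 < 2 * n → ∀ a b v w, (⟨a, b, v⟩ : Game ℕ ℕ) ∈ D t →
      (⟨a, b, w⟩ : Game ℕ ℕ) ∉ D (t + 1))
    (hbx : ∀ a v t, t + 3 < 2 * n → ¬ ∀ i < 4, ∃ b, (⟨a, b, v⟩ : Game ℕ ℕ) ∈ D (t + i))
    (hby : ∀ b v t, t + 3 < 2 * n → ¬ ∀ i < 4, ∃ a, (⟨a, b, v⟩ : Game ℕ ℕ) ∈ D (t + i)) :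
    IsFeasible (fun t : Fin (2 * n) =>
      {g : Game X Y | (⟨labX g.x, labY g.y, g.venue⟩ : Game ℕ ℕ) ∈ D t}) := by
  have : Finite X := .of_equiv _ labX.symm
  have : Finite Y := .of_equiv _ labY.symm
  have : Finite (Game X Y) := .of_equiv _ (gameEquiv X Y).symm
  have cX : Nat.card X = n := by rw [Nat.card_congr labX, Nat.card_fin]
  have cY : Nat.card Y = n := by rw [Nat.card_congr labY, Nat.card_fin]
  have cG : Nat.card (Game X Y) = n * n * 2 := by
    rw [Nat.card_congr (gameEquiv X Y), Nat.card_prod, Nat.card_prod, cX, cY]; simp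
  have hex' (g : Game X Y) :
      ∃ t : Fin (2 * n), (⟨labX g.x, labY g.y, g.venue⟩ : Game ℕ ℕ) ∈ D t := by
    obtain ⟨t, ht, h⟩ := hex (labX g.x) (labX g.x).2 (labY g.y) (labY g.y).2 g.venue
    exact ⟨⟨t, ht⟩, h⟩
  -- There are `2n²` games and `2n · n` pairs of a day and a team. The first component settles one
  -- league's daily games, the second the double round robin.
  obtain ⟨hX, hT⟩ := existsUnique_of_card_eq (G := Game X Y) (D := Fin (2 * n) × X)
    (by rw [cG, Nat.card_prod, cX, Nat.card_fin]; ring)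
    (R := fun g d => (⟨labX g.x, labY g.y, g.venue⟩ : Game ℕ ℕ) ∈ D d.1 ∧ g.x = d.2)
    (fun g => (hex' g).elim fun t h => ⟨(t, g.x), h, rfl⟩)
    (by
      rintro ⟨t, x⟩ ⟨x1, y1, v⟩ ⟨x2, y2, w⟩ ⟨h1, e1⟩ ⟨h2, e2⟩
      dsimp only at h1 e1 h2 e2
      subst e1 e2
      obtain ⟨e, rfl⟩ := hx t t.2 _ _ _ _ _ h1 h2
      rw [labY.injective (Fin.ext e)])
  obtain ⟨hY, -⟩ := existsUnique_of_card_eq (G := Game X Y) (D := Fin (2 * n) × Y)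
    (by rw [cG, Nat.card_prod, cY, Nat.card_fin]; ring)
    (R := fun g d => (⟨labX g.x, labY g.y, g.venue⟩ : Game ℕ ℕ) ∈ D d.1 ∧ g.y = d.2)
    (fun g => (hex' g).elim fun t h => ⟨(t, g.y), h, rfl⟩)
    (by
      rintro ⟨t, y⟩ ⟨x1, y1, v⟩ ⟨x2, y2, w⟩ ⟨h1, e1⟩ ⟨h2, e2⟩
      dsimp only at h1 e1 h2 e2
      subst e1 e2
      obtain ⟨e, rfl⟩ := hy t t.2 _ _ _ _ _ h1 h2
      rw [labX.injective (Fin.ext e)])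
  refine ⟨fun t x => hX (t, x), fun t y => hY (t, y), fun g => ?_, ?_, ?_, ?_⟩
  · obtain ⟨t, ht⟩ := hex' g
    exact ⟨t, ht, fun t' ht' =>
      congrArg Prod.fst ((hT g).unique (y₁ := (t', g.x)) (y₂ := (t, g.x)) ⟨ht', rfl⟩ ⟨ht, rfl⟩)⟩
  · rintro ⟨t, ht⟩ ⟨t', ht'⟩ e ⟨x, y, v⟩ hg ⟨x', y', w⟩ hg' ⟨h1, h2⟩
    dsimp only at e h1 h2
    subst e h1 h2
    exact hnr t ht' _ _ _ _ hg hg'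
  · intro x v t ht h
    refine hbx (labX x) v t ht fun i hi => ?_
    obtain ⟨⟨x', y, w⟩, hg, rfl, rfl⟩ := h ⟨i, hi⟩
    exact ⟨labY y, hg⟩
  · intro y v t ht h
    refine hby (labY y) v t ht fun i hi => ?_
    obtain ⟨⟨x, y', w⟩, hg, rfl, rfl⟩ := h ⟨i, hi⟩
    exact ⟨labX x, hg⟩

section Rotation

variable {n m d : ℕ}

theorem Admissible.pos_mul (h : Admissible n m d) : 0 < m * d :=
  Nat.mul_pos h.2.1.pos h.1

theorem newConstructionDay_of_ne (hl : n - 3 * m * d ≠ 1) (t : ℕ) :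
    newConstructionDay n m d t = constructionDay n m d t := if_neg hl

theorem newConstructionDay_zero (hl : n - 3 * m * d = 1) :
    newConstructionDay n m d 0 = constructionDay n m d (2 * n - 1) := by
  rw [newConstructionDay, if_pos hl, zero_add, Nat.mod_eq_of_lt (by omega)]

theorem newConstructionDay_succ (hl : n - 3 * m * d = 1) {t : ℕ} (ht : t < 2 * n) :
    newConstructionDay n m d (t + 1) = constructionDay n m d t := by
  rw [newConstructionDay, if_pos hl, show t + 1 + (2 * n - 1) = t + 2 * n by omega,
    Nat.add_mod_right, Nat.mod_eq_of_lt ht]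

/-- The days of the modified construction are those of the construction in another order. -/
theorem exists_newConstructionDay_eq (hn : 1 ≤ n) {t : ℕ} (ht : t < 2 * n) :
    ∃ t' < 2 * n, newConstructionDay n m d t = constructionDay n m d t' := by
  unfold newConstructionDay
  split_ifs
  · exact ⟨_, Nat.mod_lt _ (by omega), rfl⟩
  · exact ⟨t, ht, rfl⟩

theorem exists_eq_newConstructionDay (hn : 1 ≤ n) {t : ℕ} (ht : t < 2 * n) :
    ∃ t' < 2 * n, newConstructionDay n m d t' = constructionDay n m d t := by
  by_cases hl : n - 3 * m * d = 1
  · rcases Nat.lt_or_ge (t + 1) (2 * n) with h | h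
    · exact ⟨t + 1, h, newConstructionDay_succ hl ht⟩
    · obtain rfl : t = 2 * n - 1 := by omega
      exact ⟨0, by omega, newConstructionDay_zero hl⟩
  · exact ⟨t, ht, newConstructionDay_of_ne hl t⟩

/-- `G` fixes one team and leaves the opponent and the venue free, so the same argument serves both
leagues. -/
theorem newConstructionDay_not_four (h : Admissible n m d) {G : ℕ → Venue → Game ℕ ℕ} {c : ℕ}
    {Q : ℕ → Prop} (hc : c < 3)
    (hQ : ∀ t b v, G b v ∈ constructionDay n m d t → (v = .Y ↔ VenuePattern n m d c Q t))
    (v : Venue) (t : ℕ) (ht : t + 3 < 2 * n) :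
    ¬ ∀ i < 4, ∃ b, G b v ∈ newConstructionDay n m d (t + i) := by
  intro hg
  by_cases hl : n - 3 * m * d = 1
  · rcases t with _ | t
    · refine VenuePattern.not_four_rotated (Q := Q) hc (v = .Y) hl h.pos_mul ⟨?_, fun i hi => ?_⟩
      · obtain ⟨b, hb⟩ := hg 0 (by omega)
        rw [newConstructionDay_zero hl] at hb
        exact hQ _ _ _ hb
      · obtain ⟨b, hb⟩ := hg (i + 1) (by omega)
        rw [zero_add, newConstructionDay_succ hl (by omega)] at hb
        exact hQ _ _ _ hb
    · refine VenuePattern.not_four (Q := Q) hc (v = .Y) h.2.2.1 (by omega : t + 3 < 2 * n)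
        fun i hi => ?_
      obtain ⟨b, hb⟩ := hg i hi
      rw [add_right_comm, newConstructionDay_succ hl (by omega)] at hb
      exact hQ _ _ _ hb
  · refine VenuePattern.not_four (Q := Q) hc (v = .Y) h.2.2.1 (by omega : t + 3 < 2 * n)
        fun i hi => ?_
    obtain ⟨b, hb⟩ := hg i hi
    rw [newConstructionDay_of_ne hl] at hb
    exact hQ _ _ _ hb

theorem newConstructionDay_no_repeat (h : Admissible n m d) {t a b : ℕ} {v w : Venue}
    (ht : t + 1 < 2 * n) (hg : (⟨a, b, v⟩ : Game ℕ ℕ) ∈ newConstructionDay n m d t) :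
    (⟨a, b, w⟩ : Game ℕ ℕ) ∉ newConstructionDay n m d (t + 1) := by
  by_cases hl : n - 3 * m * d = 1
  · rw [newConstructionDay_succ hl (by omega)]
    rcases t with _ | t
    · rw [newConstructionDay_zero hl] at hg
      have h1 := two_mul_eq h.2.2.1
      have h2 : 6 * m * d = 6 * (m * d) := by ring
      have h3 := h.pos_mul
      -- The moved day comes from the last slot and is now followed by day 0, which lies before that
      -- slot because `md > 0`; such days share no pair.
      exact fun hg' =>
        constructionDay_last_disjoint h (by omega) (by omega) (by omega) hg' hg
    · rw [newConstructionDay_succ hl (by omega)] at hg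
      exact constructionDay_no_repeat h (by omega) (fun _ => by omega) hg
  · rw [newConstructionDay_of_ne hl] at hg ⊢
    exact constructionDay_no_repeat h ht (fun e => absurd e hl) hg

end Rotation

theorem isFeasible_newConstruction {n m d : ℕ} (hn : 1 ≤ n) (h : Admissible n m d) {X Y : Type*}
    (labX : X ≃ Fin n) (labY : Y ≃ Fin n) : IsFeasible (newConstruction n m d labX labY) := by
  refine isFeasible_of_days labX labY (newConstructionDay n m d) ?_ ?_ ?_ ?_ ?_ ?_
  · intro a ha b hb v
    obtain ⟨t, ht, hg⟩ := exists_day h ha hb v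
    obtain ⟨t', ht', e⟩ := exists_eq_newConstructionDay (m := m) (d := d) hn ht
    exact ⟨t', ht', e ▸ hg⟩
  · intro t ht a b b' v w hg hg'
    obtain ⟨t', ht', e⟩ := exists_newConstructionDay_eq (m := m) (d := d) hn ht
    rw [e] at hg hg'
    exact constructionDay_right_unique h ht' hg hg'
  · intro t ht a a' b v w hg hg'
    obtain ⟨t', ht', e⟩ := exists_newConstructionDay_eq (m := m) (d := d) hn ht
    rw [e] at hg hg'
    exact constructionDay_left_unique h ht' hg hg'
  · exact fun t ht a b v w hg => newConstructionDay_no_repeat h ht hg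
  · intro a v t ht
    obtain ⟨Q, hQ⟩ := exists_venuePattern_x h a
    exact newConstructionDay_not_four h (G := fun b v => ⟨a, b, v⟩) (Nat.mod_lt a (by omega)) hQ
      v t ht
  · intro b v t ht
    obtain ⟨Q, hQ⟩ := exists_venuePattern_y h b
    exact newConstructionDay_not_four h (G := fun a v => ⟨a, b, v⟩) (Nat.mod_lt b (by omega)) hQ
      v t ht

end BTTP

theorem theorem2 (n : ℕ) (hn : 1 ≤ n) :
    ((∃ m d : ℕ, BTTP.Admissible n m d) ↔ n ∉ ({1, 2, 5, 8, 14} : Set ℕ)) ∧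
    ∀ m d : ℕ, BTTP.Admissible n m d →
      ∀ (X Y : Type*) (labX : X ≃ Fin n) (labY : Y ≃ Fin n),
        BTTP.IsFeasible (BTTP.newConstruction n m d labX labY) :=
  ⟨BTTP.exists_admissible_iff n hn, fun _ _ h _ _ labX labY =>
    BTTP.isFeasible_newConstruction hn h labX labY⟩
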